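/- All graphs have the same finite vertex set $\mathbf V$. A MAG is a maximal ancestral graph with directed and bidirected edges; a PAG displays the common skeleton of a Markov equivalence class (MEC) of MAGs, the tails and the arrowheads shared by all its members, and circles elsewhere. Separation in a PAG is defined through definite m-connecting paths, on which every non-endpoint is a collider that is an ancestor of (or belongs to) the conditioning set, or a definite non-collider outside it. $\operatorname{MinSep}_{\mathcal P}(X,Y)$ is the set of inclusion-minimal sets $\mathbf Z\subseteq\mathbf V\setminus\{X,Y\}$ that m-separate $X$ and $Y$ in $\mathcal P$. Let $M_0$ be a MAG and $r\ge 0$. An $r$-MEC of $M_0$ is the MEC of a MAG $M$ that has the same m-separations as $M_0$ relative to all conditioning sets of size at most $r$, and in which any two distinct non-adjacent vertices are m-separated by a set of size at most $r$. Its PAG $\mathcal P^{(r)}$ is called an $r$-PAG. A path $\langle X,\dots,A,B,C\rangle$ with at least three edges is discriminating for $B$ if $X$ and $C$ are not adjacent and every vertex strictly between $X$ and $B$ is a collider on the path and a parent of $C$. A triple $\langle A,B,C\rangle$ has order $0$ in a MAG if it is unshielded; it has order at most $n+1$ if it has order at most $n$, or if it ends a discriminating path $\langle X,\dots,A,B,C\rangle$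 for $B$ whose collider triples before $B$ all have order at most $n$ (read in either direction). It is a triple with order in $\mathcal P^{(r)}$ if it has some order in a MAG of the $r$-MEC. It is a collider (non-collider) triple of $\mathcal P^{(r)}$ if it is a collider (definite non-collider) there. It corresponds to a pair of non-adjacent vertices $\{X,Y\}$ in $\mathcal P^{(r)}$ if it is unshielded with $X=A$, $Y=C$, or if it ends a discriminating path for $B$ in $\mathcal P^{(r)}$ of the form $\langle X,\dots,A,B,Y\rangle$ with $Y=C$, or $\langle Y,\dots,A,B,X\rangle$ with $X=C$. **Proposition.** Let $\langle A,B,C\rangle$ be a triple with order in an $r$-PAG $\mathcal P^{(r)}$. Then it corresponds to some pair of non-adjacent vertices $\{X,Y\}$. Moreover, for every pair $\{X,Y\}$ to which it corresponds, $\operatorname{MinSep}_{\mathcal P^{(r)}}(X,Y)$ has a member of size at most $r$, and for every $\mathbf Z\in\operatorname{MinSep}_{\mathcal P^{(r)}}(X,Y)$: - $\langle A,B,C\rangle$ is a non-collider triple if and only if $B\in\mathbf Z$; - $\langle A,B,C\rangle$ is a collider triple if and only if $B\notin\mathbf Z$. Consequently the minimal separators determine all triples with order: if two $r$-PAGs on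 $\mathbf V$ have, for every pair of vertices, the same minimal separators of size at most $r$, then they have the same non-collider triples with order and the same collider triples with order. -/

import Mathlib

/-- The three possible marks at an end of an edge. -/
inductive EdgeMark where
  | tail
  | arrow
  | circle

/-- A graph with at most one edge between two distinct vertices and a mark at each end of every
edge. `mark a b` is the mark at the end `b` of the edge between `a` and `b`; its value is
irrelevant when `a` and `b` are not adjacent. MAGs and PAGs are both of this kind. -/
structure MarkedGraph (V : Type*) extends SimpleGraph V where
  mark : V → V → EdgeMark

namespace MarkedGraph

variable {V : Type*}

/-- The directed edge `a → b`, that is, `a` is a parent of `b`. -/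
def Dir (G : MarkedGraph V) (a b : V) : Prop :=
  G.Adj a b ∧ G.mark b a = EdgeMark.tail ∧ G.mark a b = EdgeMark.arrow

/-- The bidirected edge `a ↔ b`, that is, `a` and `b` are spouses. -/
def Bidir (G : MarkedGraph V) (a b : V) : Prop :=
  G.Adj a b ∧ G.mark b a = EdgeMark.arrow ∧ G.mark a b = EdgeMark.arrow

/-- `a` is an ancestor of `b`: there is a directed path from `a` to `b`, possibly of length 0. -/
def Anc (G : MarkedGraph V) (a b : V) : Prop :=
  Relation.ReflTransGen G.Dir a b

/-- `p` is the sequence of vertices of a (simple) path from `x` to `y`. -/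
def IsPath (G : MarkedGraph V) (p : List V) (x y : V) : Prop :=
  p.IsChain G.Adj ∧ p.Nodup ∧ p.head? = some x ∧ p.getLast? = some y

/-- The triple `⟨a, b, c⟩` of consecutive vertices of a path is a collider, `a *→ b ←* c`. -/
def IsCollider (G : MarkedGraph V) (a b c : V) : Prop :=
  G.Adj a b ∧ G.Adj b c ∧ a ≠ c ∧
    G.mark a b = EdgeMark.arrow ∧ G.mark c b = EdgeMark.arrow

/-- The triple `⟨a, b, c⟩` of consecutive vertices of a path is a definite non-collider: one of
its edges is directed out of `b`, or both have a circle at `b` and `a`, `c` are not adjacent.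
In a MAG, where there are no circles and no undirected edges, this says that the triple is not a
collider. -/
def IsNonCollider (G : MarkedGraph V) (a b c : V) : Prop :=
  G.Adj a b ∧ G.Adj b c ∧ a ≠ c ∧
    (G.Dir b a ∨ G.Dir b c ∨
      (G.mark a b = EdgeMark.circle ∧ G.mark c b = EdgeMark.circle ∧ ¬ G.Adj a c))

/-- The path `p` is (definite) m-connecting relative to `Z`: every vertex of `p` other than the
endpoints is a collider that is an ancestor of some member of `Z`, or a (definite) non-collider
outside `Z`. In a MAG this is the usual m-connecting path; in a PAG it is the definite m-connecting
path (which in particular has definite status). -/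
def Active (G : MarkedGraph V) (p : List V) (Z : Finset V) : Prop :=
  ∀ a b c, [a, b, c] <:+: p →
    (G.IsCollider a b c ∧ ∃ z ∈ Z, G.Anc b z) ∨ (G.IsNonCollider a b c ∧ b ∉ Z)

/-- `X` and `Y` are m-separated by `Z` (for pairwise disjoint sets). -/
def MSep (G : MarkedGraph V) (X Y Z : Finset V) : Prop :=
  ∀ x ∈ X, ∀ y ∈ Y, ¬ ∃ p, G.IsPath p x y ∧ G.Active p Z

/-- `Z` is a separator of the pair `x`, `y`. -/
def IsSeparator (G : MarkedGraph V) (x y : V) (Z : Finset V) : Prop :=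
  x ∉ Z ∧ y ∉ Z ∧ G.MSep {x} {y} Z

/-- The set of minimal separators of the pair `x`, `y` (empty for adjacent vertices). -/
def MinSep (G : MarkedGraph V) (x y : V) : Set (Finset V) :=
  {Z | G.IsSeparator x y Z ∧ ∀ Z', Z' ⊂ Z → ¬ G.IsSeparator x y Z'}

/-- There are no directed and no almost directed cycles. -/
def IsAncestral (G : MarkedGraph V) : Prop :=
  (∀ a, ¬ Relation.TransGen G.Dir a a) ∧
    ∀ a b, G.Bidir a b → ¬ Relation.TransGen G.Dir a b

/-- There is no inducing path between two distinct non-adjacent vertices. -/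
def IsMaximal (G : MarkedGraph V) : Prop :=
  ∀ x y, x ≠ y → ¬ G.Adj x y →
    ¬ ∃ p, G.IsPath p x y ∧
      ∀ a b c, [a, b, c] <:+: p → G.IsCollider a b c ∧ (G.Anc b x ∨ G.Anc b y)

/-- Maximal ancestral graphs (with directed and bidirected edges). -/
def IsMAG (G : MarkedGraph V) : Prop :=
  (∀ a b, G.Adj a b → G.Dir a b ∨ G.Dir b a ∨ G.Bidir a b) ∧ G.IsAncestral ∧ G.IsMaximal

/-- `G` and `H` entail the same m-separations relative to conditioning sets `Z` satisfying `s`. -/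
def SameSeparations (G H : MarkedGraph V) (s : Finset V → Prop) : Prop :=
  ∀ X Y Z : Finset V, Disjoint X Y → Disjoint X Z → Disjoint Y Z → s Z →
    (G.MSep X Y Z ↔ H.MSep X Y Z)

/-- The Markov equivalence class of the MAG `M`. -/
def MEC (M : MarkedGraph V) : Set (MarkedGraph V) :=
  {N | N.IsMAG ∧ N.SameSeparations M (fun _ => True)}

/-- `P` is the PAG of the class `C` of MAGs: it has the adjacencies of the members of `C`, and it
displays exactly the tails and arrowheads that all members of `C` share (so that every other mark
is a circle). -/
def IsPAG (P : MarkedGraph V) (C : Set (MarkedGraph V)) : Prop :=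
  ∀ a b, (∀ N ∈ C, (P.Adj a b ↔ N.Adj a b)) ∧
    (P.Adj a b →
      (P.mark a b = EdgeMark.tail ↔ ∀ N ∈ C, N.mark a b = EdgeMark.tail) ∧
      (P.mark a b = EdgeMark.arrow ↔ ∀ N ∈ C, N.mark a b = EdgeMark.arrow))

/-- `C` is the `r`-MEC of the MAG `M₀`: the Markov equivalence class of a MAG `M` that
incorporates exactly the (in)dependencies of `M₀` relative to conditioning sets of at most `r`
vertices, in the sense that `M` and `M₀` have the same m-separations and m-connections relative to
such sets, and that two distinct vertices are non-adjacent in `M` only if they are separated by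
such a set. The PAG of this class is the `r`-PAG of `M₀`. -/
def IsRMEC (r : ℕ) (M₀ : MarkedGraph V) (C : Set (MarkedGraph V)) : Prop :=
  ∃ M : MarkedGraph V, M.IsMAG ∧ C = M.MEC ∧
    M.SameSeparations M₀ (fun Z => Z.card ≤ r) ∧
    ∀ x y, x ≠ y → ¬ M.Adj x y → ∃ Z : Finset V, Z.card ≤ r ∧ M.IsSeparator x y Z

/-- The unshielded triple `⟨a, b, c⟩`. -/
def IsUnshielded (G : MarkedGraph V) (a b c : V) : Prop :=
  G.Adj a b ∧ G.Adj b c ∧ a ≠ c ∧ ¬ G.Adj a c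

/-- `p = ⟨x, …, a, b, c⟩` is a discriminating path for `b`: it has at least three edges, `x` and
`c` are not adjacent, and every vertex strictly between `x` and `b` is a collider on `p` and a
parent of `c`. -/
def IsDiscriminating (G : MarkedGraph V) (p : List V) (x a b c : V) : Prop :=
  G.IsPath p x c ∧ 4 ≤ p.length ∧ [a, b, c] <:+ p ∧ ¬ G.Adj x c ∧
    ∀ u v w, [u, v, w] <:+: p.dropLast → G.IsCollider u v w ∧ G.Dir v c

/-- The triple `⟨a, b, c⟩` has order at most `n` in the MAG `G`. Order 0: the triple is unshielded.
Order at most `n + 1`: there is a discriminating path `⟨x, …, a, b, c⟩` for `b` all of whose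
collider triples before `b` have order at most `n`. A triple and its reversal are the same triple;
`HasOrderLE` lists a triple in the direction in which it ends such a path (`c` is the endpoint),
while the triples it is built on may be read in either direction. -/
def HasOrderLE (G : MarkedGraph V) : ℕ → V → V → V → Prop
  | 0, a, b, c => G.IsUnshielded a b c
  | n + 1, a, b, c => HasOrderLE G n a b c ∨
      ∃ p x, G.IsDiscriminating p x a b c ∧
        ∀ u v w, [u, v, w] <:+: p.dropLast → HasOrderLE G n u v w ∨ HasOrderLE G n w v u

/-- The triple `⟨A, B, C⟩` corresponds to the pair of non-adjacent vertices `{X, Y}`. -/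
def Corresponds (P : MarkedGraph V) (A B C X Y : V) : Prop :=
  X ≠ Y ∧ ¬ P.Adj X Y ∧
    ((X = A ∧ Y = C ∧ P.IsUnshielded A B C) ∨
      (Y = C ∧ ∃ p, P.IsDiscriminating p X A B C) ∨
      (X = C ∧ ∃ p, P.IsDiscriminating p Y A B C))

end MarkedGraph

/-- `⟨A, B, C⟩` is a triple with order in the PAG of the Markov equivalence class `K`: it has some
order in a MAG of the class. -/
def TripleWithOrder {V : Type*} (K : Set (MarkedGraph V)) (A B C : V) : Prop :=
  ∃ N ∈ K, ∃ n, N.HasOrderLE n A B C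

namespace MarkedGraph

variable {V : Type*} {G H : MarkedGraph V}

/-! A separator blocks every path between its pair. If all earlier non-endpoints of such a path are
colliders lying in the separator `Z`, only the last triple ⟨a, b, c⟩ can block it, so a collider
there forces `b ∉ Z` and a non-collider forces `b ∈ Z`. Along a discriminating path, jumping from
each collider straight to the endpoint puts that collider into `Z` by induction, so the rule applies
to the discriminated triple. This reads the status off any separator of a corresponding pair,
provided the status is definite.

Transfer (`ShareSeparators.segment`, `ShareSeparators.hasOrderLE`): two graphs with one skeleton and
common separators have the same triples with order, with the same status, by induction on the order.
It is used three times: between members of a class, from a member to the PAG, and between two PAGs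
with the same small minimal separators. The first use makes all members agree, so the PAG displays a
definite status (`IsRMEC.hasDefiniteOrder`), as the other two uses require. -/

/-! ### Paths and separators -/

theorem infix_concat_cases {u v w c : V} {l : List V} (h : [u, v, w] <:+: l ++ [c]) :
    [u, v, w] <:+: l ∨ ∃ l', l = l' ++ [u, v] ∧ w = c := by
  obtain ⟨s, t, h⟩ := h
  rcases List.eq_nil_or_concat t with rfl | ⟨t, d, rfl⟩
  · right
    have h' : (s ++ [u, v]) ++ [w] = l ++ [c] := by simpa using h
    obtain ⟨h1, h2⟩ := List.append_inj' h' rfl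
    exact ⟨s, h1.symm, by simpa using h2⟩
  · left
    have h' : (s ++ [u, v, w] ++ t) ++ [d] = l ++ [c] := by simpa using h
    obtain ⟨h1, -⟩ := List.append_inj' h' rfl
    exact ⟨s, t, h1⟩

theorem IsCollider.symm {a b c : V} (h : G.IsCollider a b c) : G.IsCollider c b a :=
  ⟨h.2.1.symm, h.1.symm, h.2.2.1.symm, h.2.2.2.2, h.2.2.2.1⟩

theorem IsNonCollider.symm {a b c : V} (h : G.IsNonCollider a b c) : G.IsNonCollider c b a := by
  refine ⟨h.2.1.symm, h.1.symm, h.2.2.1.symm, ?_⟩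
  rcases h.2.2.2 with h | h | ⟨h1, h2, h3⟩
  · exact .inr (.inl h)
  · exact .inl h
  · exact .inr (.inr ⟨h2, h1, fun h => h3 h.symm⟩)

theorem IsNonCollider.dir_of_arrow {a b c : V} (h : G.IsNonCollider a b c)
    (hab : G.mark a b = EdgeMark.arrow) : G.Dir b c := by
  rcases h.2.2.2 with h1 | h1 | h1
  · have := h1.2.1.symm.trans hab; cases this
  · exact h1
  · have := h1.1.symm.trans hab; cases this

theorem IsPath.reverse {p : List V} {x y : V} (h : G.IsPath p x y) :
    G.IsPath p.reverse y x := by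
  obtain ⟨h1, h2, h3, h4⟩ := h
  refine ⟨?_, List.nodup_reverse.2 h2, by simpa using h4, by simpa using h3⟩
  rw [List.isChain_reverse]
  exact h1.imp fun a b h => h.symm

theorem Active.reverse {p : List V} {Z : Finset V} (h : G.Active p Z) :
    G.Active p.reverse Z := by
  intro a b c habc
  have h' : [c, b, a] <:+: p := by
    have := List.reverse_infix.2 habc
    simpa using this
  rcases h c b a h' with ⟨h1, h2⟩ | ⟨h1, h2⟩
  · exact .inl ⟨h1.symm, h2⟩
  · exact .inr ⟨h1.symm, h2⟩

theorem IsSeparator.symm {x y : V} {Z : Finset V} (h : G.IsSeparator x y Z) :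
    G.IsSeparator y x Z := by
  refine ⟨h.2.1, h.1, ?_⟩
  rintro a ha b hb ⟨p, hp, hpZ⟩
  exact h.2.2 b hb a ha ⟨p.reverse, hp.reverse, hpZ.reverse⟩

theorem IsSeparator.not_active {x y : V} {Z : Finset V} (h : G.IsSeparator x y Z)
    {p : List V} (hp : G.IsPath p x y) : ¬ G.Active p Z := fun h' =>
  h.2.2 x (by simp) y (by simp) ⟨p, hp, h'⟩

theorem IsSeparator.ne {x y : V} {Z : Finset V} (h : G.IsSeparator x y Z) : x ≠ y := by
  rintro rfl
  refine h.not_active (p := [x]) ⟨by simp, by simp, by simp, by simp⟩ ?_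
  intro a b c habc
  have := habc.length_le
  simp at this

theorem IsSeparator.not_adj {x y : V} {Z : Finset V} (h : G.IsSeparator x y Z) :
    ¬ G.Adj x y := by
  intro hxy
  refine h.not_active (p := [x, y]) ⟨by simpa using hxy, by simpa using h.ne, by simp, by simp⟩ ?_
  intro a b c habc
  have := habc.length_le
  simp at this

/-! ### Separators along discriminating paths -/

/-- On a path to `c` whose collider triples before the last vertex have their middle vertices in a
separator `Z` of the endpoints, the last triple is a collider (non-collider) only if its middle
vertex is outside (inside) `Z`. -/
theorem IsSeparator.last_triple {x a b c : V} {Z : Finset V} {q : List V}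
    (hZ : G.IsSeparator x c Z) (hp : G.IsPath (q ++ [a, b] ++ [c]) x c)
    (h : ∀ u v w, [u, v, w] <:+: q ++ [a, b] → G.IsCollider u v w ∧ v ∈ Z) :
    (G.IsCollider a b c → b ∉ Z) ∧ (G.IsNonCollider a b c → b ∈ Z) := by
  -- Either alternative would make the whole path m-connecting; a collider in `Z` is activated by
  -- itself, through the directed path of length 0.
  have key : ¬ ((G.IsCollider a b c ∧ b ∈ Z) ∨ (G.IsNonCollider a b c ∧ b ∉ Z)) := by
    intro hb
    refine hZ.not_active hp ?_
    intro u v w huvw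
    rcases infix_concat_cases huvw with h' | ⟨l, hl, rfl⟩
    · exact .inl ⟨(h u v w h').1, v, (h u v w h').2, .refl⟩
    · obtain ⟨-, h2⟩ := List.append_inj' hl rfl
      obtain ⟨rfl, rfl⟩ : a = u ∧ b = v := by simpa using h2
      exact hb.imp (fun h => ⟨h.1, b, h.2, .refl⟩) id
  tauto

theorem isPath_concat {x c : V} {l : List V} {u v : V}
    (hchain : (l ++ [u, v]).IsChain G.Adj) (hnd : (l ++ [u, v]).Nodup)
    (hx : (l ++ [u, v]).head? = some x) (hc : c ∉ l ++ [u, v]) (hvc : G.Adj v c) :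
    G.IsPath (l ++ [u, v] ++ [c]) x c := by
  refine ⟨?_, ?_, ?_, by simp⟩
  · rw [List.isChain_append]
    refine ⟨hchain, by simp, ?_⟩
    intro y hy z hz
    simp at hy hz
    subst hy hz
    exact hvc
  · rw [List.nodup_append']
    refine ⟨hnd, by simp, ?_⟩
    simpa using hc
  · rw [List.head?_append, hx]; rfl

/-- `q` is an initial segment of a discriminating path from `x` to `c`. -/
structure IsDiscriminatingSegment (G : MarkedGraph V) (q : List V) (x c : V) : Prop where
  chain : q.IsChain G.Adj
  nodup : q.Nodup
  head : q.head? = some x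
  not_mem : c ∉ q
  collider : ∀ u v w, [u, v, w] <:+: q → G.IsCollider u v w
  dir : ∀ u v w, [u, v, w] <:+: q → G.Dir v c

theorem IsDiscriminatingSegment.prefix {l t : List V} {x c : V}
    (h : G.IsDiscriminatingSegment (l ++ t) x c) (hl : l ≠ []) :
    G.IsDiscriminatingSegment l x c where
  chain := (List.isChain_append.1 h.chain).1
  nodup := (List.nodup_append'.1 h.nodup).1
  head := by
    have := h.head
    cases l with
    | nil => exact absurd rfl hl
    | cons a l => simpa using this
  not_mem := fun h' => h.not_mem (List.mem_append_left _ h')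
  collider := fun u v w h' => h.collider u v w (h'.trans (List.prefix_append l t).isInfix)
  dir := fun u v w h' => h.dir u v w (h'.trans (List.prefix_append l t).isInfix)

theorem IsDiscriminatingSegment.isPath {l : List V} {x c u v : V}
    (h : G.IsDiscriminatingSegment (l ++ [u, v]) x c) (hvc : G.Adj v c) :
    G.IsPath (l ++ [u, v] ++ [c]) x c :=
  isPath_concat h.chain h.nodup h.head h.not_mem hvc

/-- A separator of `x` and `c` contains the colliders of a discriminating path. -/
theorem IsDiscriminatingSegment.mem_separator {q : List V} {x c : V} {Z : Finset V}
    (hq : G.IsDiscriminatingSegment q x c) (hZ : G.IsSeparator x c Z) :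
    ∀ u v w, [u, v, w] <:+: q → v ∈ Z := by
  induction q using List.reverseRecOn with
  | nil => intro u v w h; have := h.length_le; simp at this
  | append_singleton l d ih =>
    intro u v w h
    have hl : l ≠ [] := by
      rintro rfl; have := h.length_le; simp at this
    have hl' := hq.prefix hl
    rcases infix_concat_cases h with h' | ⟨l', rfl, rfl⟩
    · exact ih hl' u v w h'
    · have hd := hq.dir u v w h
      -- Cut the path at `v` and go directly to `c`: the edge `v → c` makes `v` a non-collider on
      -- the shortened path, while all earlier colliders are already in `Z`.
      refine (hZ.last_triple (hl'.isPath hd.1)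
        fun a b e hab => ⟨hl'.collider a b e hab, ih hl' a b e hab⟩).2 ?_
      refine ⟨(hq.collider u v w h).1, hd.1, ?_, .inr (.inl hd)⟩
      rintro rfl
      exact hl'.not_mem (by simp)

theorem IsDiscriminating.exists_segment {p : List V} {x a b c : V}
    (h : G.IsDiscriminating p x a b c) :
    ∃ l, l ≠ [] ∧ p = l ++ [a, b] ++ [c] ∧ G.IsDiscriminatingSegment (l ++ [a, b]) x c ∧
      G.Adj b c := by
  obtain ⟨⟨h1, h2, h3, -⟩, h4, ⟨l, rfl⟩, -, h5⟩ := h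
  have e : l ++ [a, b, c] = (l ++ [a, b]) ++ [c] := by simp
  rw [e] at h1 h2 h3 h4 h5 ⊢
  rw [List.dropLast_concat] at h5
  have hl : l ≠ [] := by rintro rfl; simp at h4
  refine ⟨l, hl, rfl, ⟨(List.isChain_append.1 h1).1, (List.nodup_append'.1 h2).1, ?_, ?_,
    fun u v w h => (h5 u v w h).1, fun u v w h => (h5 u v w h).2⟩, ?_⟩
  · cases l with
    | nil => exact absurd rfl hl
    | cons a l => simpa using h3
  · intro hc
    exact (List.nodup_append'.1 h2).2.2 hc (by simp)
  · exact (List.isChain_append.1 h1).2.2 b (by simp) c (by simp)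

theorem IsDiscriminatingSegment.isDiscriminating {l : List V} {x a b c : V}
    (h : G.IsDiscriminatingSegment (l ++ [a, b]) x c) (hl : l ≠ []) (hbc : G.Adj b c)
    (hxc : ¬ G.Adj x c) : G.IsDiscriminating (l ++ [a, b] ++ [c]) x a b c := by
  refine ⟨h.isPath hbc, ?_, ⟨l, by simp⟩, hxc, ?_⟩
  · have := List.length_pos_iff.2 hl
    simp; omega
  · rw [List.dropLast_concat]
    exact fun u v w h' => ⟨h.collider u v w h', h.dir u v w h'⟩

theorem IsDiscriminating.ne {p : List V} {x a b c : V} (h : G.IsDiscriminating p x a b c) :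
    x ≠ c := by
  obtain ⟨l, -, -, hs, -⟩ := h.exists_segment
  rintro rfl
  exact hs.not_mem (List.mem_of_head? hs.head)

theorem IsDiscriminating.last_triple {p : List V} {x a b c : V} {Z : Finset V}
    (h : G.IsDiscriminating p x a b c) (hZ : G.IsSeparator x c Z) :
    (G.IsCollider a b c → b ∉ Z) ∧ (G.IsNonCollider a b c → b ∈ Z) := by
  obtain ⟨l, -, rfl, hs, hbc⟩ := h.exists_segment
  exact hZ.last_triple (hs.isPath hbc)
    fun u v w h => ⟨hs.collider u v w h, hs.mem_separator hZ u v w h⟩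

theorem IsUnshielded.last_triple {a b c : V} {Z : Finset V}
    (h : G.IsUnshielded a b c) (hZ : G.IsSeparator a c Z) :
    (G.IsCollider a b c → b ∉ Z) ∧ (G.IsNonCollider a b c → b ∈ Z) := by
  refine hZ.last_triple (q := []) ⟨by simp [h.1, h.2.1], ?_, by simp, by simp⟩ ?_
  · simp [h.1.ne, h.2.1.ne, h.2.2.1]
  · intro u v w h; have := h.length_le; simp at this

/-- The first vertex of the triple that ends a discriminating path is a collider on the path and a
parent of its endpoint. -/
theorem IsDiscriminating.penultimate {p : List V} {x a b c : V}
    (h : G.IsDiscriminating p x a b c) : G.mark b a = EdgeMark.arrow ∧ G.Dir a c ∧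
      G.Adj a b ∧ G.Adj b c ∧ a ≠ c := by
  obtain ⟨l, hl, rfl, hs, hbc⟩ := h.exists_segment
  obtain ⟨l, d, rfl⟩ := (List.eq_nil_or_concat l).resolve_left hl
  have hi : [d, a, b] <:+: l.concat d ++ [a, b] := ⟨l, [], by simp⟩
  have hcol := hs.collider _ _ _ hi
  exact ⟨hcol.2.2.2.2, hs.dir _ _ _ hi, hcol.2.1, hbc, (hs.dir _ _ _ hi).1.ne⟩

theorem HasOrderLE.adj {n : ℕ} {a b c : V} (h : G.HasOrderLE n a b c) :
    G.Adj a b ∧ G.Adj b c ∧ a ≠ c := by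
  induction n with
  | zero => exact ⟨h.1, h.2.1, h.2.2.1⟩
  | succ n ih =>
    rcases h with h | ⟨p, x, hp, -⟩
    · exact ih h
    · exact hp.penultimate.2.2

theorem HasOrderLE.of_isUnshielded {a b c : V} (h : G.IsUnshielded a b c) (n : ℕ) :
    G.HasOrderLE n a b c := by
  induction n with
  | zero => exact h
  | succ n ih => exact .inl ih

/-! ### Transfer between graphs with common separators -/

/-- Every triple with order has definite status. -/
def HasDefiniteOrder (G : MarkedGraph V) : Prop :=
  ∀ n a b c, G.HasOrderLE n a b c → G.IsCollider a b c ∨ G.IsNonCollider a b c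

/-- `G` and `H` have the same skeleton, and any two non-adjacent vertices have a common
separator. -/
structure ShareSeparators (G H : MarkedGraph V) : Prop where
  adj : ∀ a b, G.Adj a b ↔ H.Adj a b
  sep : ∀ x y, x ≠ y → ¬ G.Adj x y → ∃ Z, G.IsSeparator x y Z ∧ H.IsSeparator x y Z

/-- What needs proof is the direction `v → c` in `H`. A common separator contains `v` because of
`G`. In `H` the triple ⟨u, v, c⟩ itself has order, so its status is definite and membership makes it
a non-collider; the arrowhead at `v` from `u` then leaves only `v → c`. -/
theorem ShareSeparators.segment (hGH : G.ShareSeparators H) (hH : H.HasDefiniteOrder)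
    {q : List V} {x c : V} {n : ℕ} (hq : G.IsDiscriminatingSegment q x c) (hxc : ¬ G.Adj x c)
    (hcol : ∀ u v w, [u, v, w] <:+: q → H.IsCollider u v w)
    (hord : ∀ u v w, [u, v, w] <:+: q → H.HasOrderLE n u v w ∨ H.HasOrderLE n w v u) :
    H.IsDiscriminatingSegment q x c := by
  refine ⟨hq.chain.imp fun a b => (hGH.adj a b).1, hq.nodup, hq.head, hq.not_mem, hcol, ?_⟩
  induction q using List.reverseRecOn with
  | nil => intro u v w h; have := h.length_le; simp at this
  | append_singleton l d ih =>
    intro u v w h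
    have hl : l ≠ [] := by
      rintro rfl; have := h.length_le; simp at this
    have hsub : ∀ a b e, [a, b, e] <:+: l → [a, b, e] <:+: l ++ [d] :=
      fun a b e h => h.trans (List.prefix_append l [d]).isInfix
    have hl' := hq.prefix hl
    have ih' := ih hl' (fun a b e h => hcol a b e (hsub a b e h))
      (fun a b e h => hord a b e (hsub a b e h))
    rcases infix_concat_cases h with h' | ⟨l', rfl, rfl⟩
    · exact ih' u v w h'
    · have hs : H.IsDiscriminatingSegment (l' ++ [u, v]) x c :=
        ⟨hl'.chain.imp fun a b => (hGH.adj a b).1, hl'.nodup, hl'.head, hl'.not_mem,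
          fun a b e h => hcol a b e (hsub a b e h), ih'⟩
      have hne : x ≠ c := by
        rintro rfl; exact hq.not_mem (List.mem_of_head? hq.head)
      obtain ⟨Z, hZG, hZH⟩ := hGH.sep x c hne hxc
      have hvZ : v ∈ Z := hq.mem_separator hZG u v w h
      have hvc : H.Adj v c := (hGH.adj v c).1 (hq.dir u v w h).1
      have hxc' : ¬ H.Adj x c := fun h => hxc ((hGH.adj x c).2 h)
      have hlast := hZH.last_triple (hs.isPath hvc)
        fun a b e h => ⟨hs.collider a b e h, hq.mem_separator hZG a b e (hsub a b e h)⟩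
      have huvw := hcol u v w h
      have hdef : H.HasOrderLE (n + 1) u v c := by
        -- If nothing precedes `u`, then `u` is the start `x` and the triple is unshielded;
        -- otherwise it ends a discriminating path.
        rcases eq_or_ne l' [] with rfl | hl''
        · have hux : u = x := by simpa using hl'.head
          subst hux
          exact HasOrderLE.of_isUnshielded ⟨huvw.1, hvc, hne, hxc'⟩ _
        · refine .inr ⟨_, x, hs.isDiscriminating hl'' hvc hxc', ?_⟩
          rw [List.dropLast_concat]
          exact fun a b e h => hord a b e (hsub a b e h)
      rcases hH _ _ _ _ hdef with h' | h'
      · exact absurd hvZ (hlast.1 h')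
      · exact h'.dir_of_arrow huvw.2.2.2.1

/-- `⟨a, b, c⟩` has the same status in `G` and `H`. -/
def SameStatus (G H : MarkedGraph V) (a b c : V) : Prop :=
  (G.IsCollider a b c ↔ H.IsCollider a b c) ∧ (G.IsNonCollider a b c ↔ H.IsNonCollider a b c)

/-- The induction must carry order and status together: the status at level `n` turns the collider
triples of a discriminating path in `G` into colliders in `H`, which gives the path in `H` and hence
the order at level `n + 1`. -/
theorem ShareSeparators.hasOrderLE (hGH : G.ShareSeparators H) (hG : G.HasDefiniteOrder)
    (hH : H.HasDefiniteOrder) (n : ℕ) : ∀ a b c, G.HasOrderLE n a b c →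
      H.HasOrderLE n a b c ∧ G.SameStatus H a b c := by
  have status : ∀ {n m a b c} {Z : Finset V}, G.HasOrderLE n a b c → H.HasOrderLE m a b c →
      ((G.IsCollider a b c → b ∉ Z) ∧ (G.IsNonCollider a b c → b ∈ Z)) →
      ((H.IsCollider a b c → b ∉ Z) ∧ (H.IsNonCollider a b c → b ∈ Z)) →
      G.SameStatus H a b c := by
    intro n m a b c Z h1 h2 h3 h4
    have h5 := hG _ _ _ _ h1
    have h6 := hH _ _ _ _ h2
    have : b ∈ Z ∨ b ∉ Z := em _
    unfold SameStatus
    tauto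
  induction n with
  | zero =>
    intro a b c h
    have h' : H.IsUnshielded a b c :=
      ⟨(hGH.adj _ _).1 h.1, (hGH.adj _ _).1 h.2.1, h.2.2.1, fun h' => h.2.2.2 ((hGH.adj _ _).2 h')⟩
    obtain ⟨Z, hZG, hZH⟩ := hGH.sep a c h.2.2.1 h.2.2.2
    exact ⟨h', status (n := 0) (m := 0) h h' (IsUnshielded.last_triple h hZG) (h'.last_triple hZH)⟩
  | succ n ih =>
    intro a b c h
    rcases id h with h' | ⟨p, x, hp, hord⟩
    · exact ⟨.inl (ih a b c h').1, (ih a b c h').2⟩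
    · obtain ⟨l, hl, rfl, hs, hbc⟩ := hp.exists_segment
      rw [List.dropLast_concat] at hord
      have hxc := hp.2.2.2.1
      have hordH : ∀ u v w, [u, v, w] <:+: l ++ [a, b] →
          H.HasOrderLE n u v w ∨ H.HasOrderLE n w v u := fun u v w h =>
        (hord u v w h).imp (fun h => (ih _ _ _ h).1) (fun h => (ih _ _ _ h).1)
      have hcolH : ∀ u v w, [u, v, w] <:+: l ++ [a, b] → H.IsCollider u v w := by
        intro u v w h
        rcases hord u v w h with h' | h'
        · exact (ih _ _ _ h').2.1.1 (hs.collider u v w h)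
        · exact ((ih _ _ _ h').2.1.1 (hs.collider u v w h).symm).symm
      have hsH := (hGH.segment hH hs hxc hcolH hordH).isDiscriminating hl ((hGH.adj _ _).1 hbc)
        fun h => hxc ((hGH.adj _ _).2 h)
      have hH' : H.HasOrderLE (n + 1) a b c := by
        refine .inr ⟨_, x, hsH, ?_⟩
        rwa [List.dropLast_concat]
      obtain ⟨Z, hZG, hZH⟩ := hGH.sep x c hp.ne hxc
      exact ⟨hH', status h hH' (hp.last_triple hZG) (hsH.last_triple hZH)⟩

/-! ### Status of triples in a MAG -/

theorem IsMAG.isCollider_or_isNonCollider (hG : G.IsMAG) {a b c : V} (hab : G.Adj a b)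
    (hbc : G.Adj b c) (hac : a ≠ c) : G.IsCollider a b c ∨ G.IsNonCollider a b c := by
  rcases hG.1 a b hab with h | h | h
  · rcases hG.1 b c hbc with h' | h' | h'
    · exact .inr ⟨hab, hbc, hac, .inr (.inl h')⟩
    · exact .inl ⟨hab, hbc, hac, h.2.2, h'.2.2⟩
    · exact .inl ⟨hab, hbc, hac, h.2.2, h'.2.1⟩
  · exact .inr ⟨hab, hbc, hac, .inl h⟩
  · rcases hG.1 b c hbc with h' | h' | h'
    · exact .inr ⟨hab, hbc, hac, .inr (.inl h')⟩
    · exact .inl ⟨hab, hbc, hac, h.2.2, h'.2.2⟩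
    · exact .inl ⟨hab, hbc, hac, h.2.2, h'.2.1⟩

theorem IsMAG.hasDefiniteOrder (hG : G.IsMAG) : G.HasDefiniteOrder := fun _ _ _ _ h =>
  hG.isCollider_or_isNonCollider h.adj.1 h.adj.2.1 h.adj.2.2

theorem IsMAG.mark_ne_circle (hG : G.IsMAG) {a b : V} (hab : G.Adj a b) :
    G.mark a b ≠ EdgeMark.circle := by
  rcases hG.1 a b hab with h | h | h
  · simp [h.2.2]
  · simp [h.2.1]
  · simp [h.2.2]

theorem IsMAG.dir_of_mark_tail (hG : G.IsMAG) {a b : V} (hab : G.Adj a b)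
    (h : G.mark b a = EdgeMark.tail) : G.Dir a b := by
  rcases hG.1 a b hab with h' | h' | h'
  · exact h'
  · rw [h'.2.2] at h; cases h
  · rw [h'.2.1] at h; cases h

/-- A discriminated non-collider is a parent of the endpoint of the discriminating path. -/
theorem IsMAG.dir_of_isDiscriminating (hG : G.IsMAG) {p : List V} {x a b c : V}
    (hp : G.IsDiscriminating p x a b c) (h : G.IsNonCollider a b c) : G.Dir b c := by
  obtain ⟨-, hac, -, hbc, -⟩ := hp.penultimate
  rcases h.2.2.2 with h1 | h1 | h1
  · have ht : Relation.TransGen G.Dir b c := .tail (.single h1) hac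
    rcases hG.1 b c hbc with h' | h' | h'
    · exact h'
    · exact absurd (ht.tail h') (hG.2.1.1 b)
    · exact absurd ht (hG.2.1.2 b c h')
  · exact h1
  · exact absurd h1.1 (hG.mark_ne_circle h.1)

/-! ### Members of an `r`-MEC and their PAG -/

section PAG

variable {P : MarkedGraph V} {K : Set (MarkedGraph V)} {r : ℕ} {M₀ : MarkedGraph V}

theorem IsPAG.dir_iff (hP : P.IsPAG K) {a b : V} (hab : P.Adj a b) :
    P.Dir a b ↔ ∀ N ∈ K, N.Dir a b := by
  have h1 := ((hP b a).2 hab.symm).1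
  have h2 := ((hP a b).2 hab).2
  constructor
  · exact fun h N hN => ⟨((hP a b).1 N hN).1 hab, h1.1 h.2.1 N hN, h2.1 h.2.2 N hN⟩
  · exact fun h => ⟨hab, h1.2 fun N hN => (h N hN).2.1, h2.2 fun N hN => (h N hN).2.2⟩

theorem IsPAG.dir (hP : P.IsPAG K) {N : MarkedGraph V} (hN : N ∈ K) {a b : V}
    (h : P.Dir a b) : N.Dir a b := (hP.dir_iff h.1).1 h N hN

theorem IsPAG.isCollider (hP : P.IsPAG K) {N : MarkedGraph V} (hN : N ∈ K) {a b c : V}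
    (h : P.IsCollider a b c) : N.IsCollider a b c :=
  ⟨((hP a b).1 N hN).1 h.1, ((hP b c).1 N hN).1 h.2.1, h.2.2.1,
    ((hP a b).2 h.1).2.1 h.2.2.2.1 N hN, ((hP c b).2 h.2.1.symm).2.1 h.2.2.2.2 N hN⟩

theorem IsPAG.isCollider_of_forall (hP : P.IsPAG K) {a b c : V} (hab : P.Adj a b)
    (hbc : P.Adj b c) (hac : a ≠ c) (h : ∀ N ∈ K, N.IsCollider a b c) : P.IsCollider a b c :=
  ⟨hab, hbc, hac, ((hP a b).2 hab).2.2 fun N hN => (h N hN).2.2.2.1,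
    ((hP c b).2 hbc.symm).2.2 fun N hN => (h N hN).2.2.2.2⟩

theorem IsPAG.isDiscriminating (hP : P.IsPAG K) {N : MarkedGraph V} (hN : N ∈ K) {p : List V}
    {x a b c : V} (h : P.IsDiscriminating p x a b c) : N.IsDiscriminating p x a b c :=
  ⟨⟨h.1.1.imp fun a b => ((hP a b).1 N hN).1, h.1.2⟩, h.2.1, h.2.2.1,
    fun h' => h.2.2.2.1 (((hP _ _).1 N hN).2 h'), fun u v w h' =>
      ⟨hP.isCollider hN (h.2.2.2.2 u v w h').1, hP.dir hN (h.2.2.2.2 u v w h').2⟩⟩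

theorem IsPAG.isUnshielded_iff (hP : P.IsPAG K) {N : MarkedGraph V} (hN : N ∈ K) {a b c : V} :
    P.IsUnshielded a b c ↔ N.IsUnshielded a b c := by
  simp only [IsUnshielded, (hP a b).1 N hN, (hP b c).1 N hN, (hP a c).1 N hN]

theorem IsPAG.hasOrderLE (hP : P.IsPAG K) {N : MarkedGraph V} (hN : N ∈ K) (n : ℕ) :
    ∀ a b c, P.HasOrderLE n a b c → N.HasOrderLE n a b c := by
  induction n with
  | zero => exact fun a b c h => (hP.isUnshielded_iff hN).1 h
  | succ n ih =>
    rintro a b c (h | ⟨p, x, hp, h⟩)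
    · exact .inl (ih a b c h)
    · exact .inr ⟨p, x, hP.isDiscriminating hN hp,
        fun u v w h' => (h u v w h').imp (ih _ _ _) (ih _ _ _)⟩

theorem IsPAG.anc (hP : P.IsPAG K) {N : MarkedGraph V} (hN : N ∈ K) {a b : V}
    (h : P.Anc a b) : N.Anc a b :=
  Relation.ReflTransGen.mono (fun _ _ h => hP.dir hN h) _ _ h

theorem SameSeparations.isSeparator (h : G.SameSeparations H (fun _ => True)) {x y : V}
    {Z : Finset V} (hZ : H.IsSeparator x y Z) : G.IsSeparator x y Z :=
  ⟨hZ.1, hZ.2.1, (h {x} {y} Z (by simpa using hZ.ne) (by simpa using hZ.1)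
    (by simpa using hZ.2.1) trivial).2 hZ.2.2⟩

theorem IsRMEC.nonempty (hK : IsRMEC r M₀ K) : K.Nonempty := by
  obtain ⟨M, hM, rfl, -⟩ := hK
  exact ⟨M, hM, fun _ _ _ _ _ _ _ => Iff.rfl⟩

theorem IsRMEC.isMAG (hK : IsRMEC r M₀ K) {N : MarkedGraph V} (hN : N ∈ K) : N.IsMAG := by
  obtain ⟨M, hM, rfl, -⟩ := hK
  exact hN.1

/-- Markov equivalence makes the small separator found in one member work in all of them at once. -/
theorem IsRMEC.exists_separator (hK : IsRMEC r M₀ K) (hP : P.IsPAG K) {x y : V} (hxy : x ≠ y)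
    (h : ¬ P.Adj x y) : ∃ Z : Finset V, Z.card ≤ r ∧ ∀ N ∈ K, N.IsSeparator x y Z := by
  obtain ⟨M, hM, rfl, -, hsep⟩ := hK
  have hMK : M ∈ M.MEC := ⟨hM, fun _ _ _ _ _ _ _ => Iff.rfl⟩
  obtain ⟨Z, hZ, hZM⟩ := hsep x y hxy fun h' => h (((hP x y).1 M hMK).2 h')
  exact ⟨Z, hZ, fun N hN => hN.2.isSeparator hZM⟩

theorem IsRMEC.shareSeparators (hK : IsRMEC r M₀ K) (hP : P.IsPAG K) {N N' : MarkedGraph V}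
    (hN : N ∈ K) (hN' : N' ∈ K) : N.ShareSeparators N' where
  adj a b := ((hP a b).1 N hN).symm.trans ((hP a b).1 N' hN')
  sep x y hxy h := by
    obtain ⟨Z, -, hZ⟩ := hK.exists_separator hP hxy fun h' => h (((hP x y).1 N hN).1 h')
    exact ⟨Z, hZ N hN, hZ N' hN'⟩

/-- All members of an `r`-MEC agree on the triples with order and their status. -/
theorem IsRMEC.hasOrderLE (hK : IsRMEC r M₀ K) (hP : P.IsPAG K) {N N' : MarkedGraph V}
    (hN : N ∈ K) (hN' : N' ∈ K) {n : ℕ} {a b c : V} (h : N.HasOrderLE n a b c) :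
    N'.HasOrderLE n a b c ∧ N.SameStatus N' a b c :=
  (hK.shareSeparators hP hN hN').hasOrderLE (hK.isMAG hN).hasDefiniteOrder
    (hK.isMAG hN').hasDefiniteOrder n a b c h

/-- An arrowhead at `b` displayed on one edge forces the other edge out of `b` in every member, and
a displayed tail is already such an edge; two circles are allowed because the triple is unshielded.
-/
theorem IsRMEC.isNonCollider_of_isUnshielded (hK : IsRMEC r M₀ K) (hP : P.IsPAG K) {a b c : V}
    (hu : P.IsUnshielded a b c) (h : ∀ N ∈ K, N.IsNonCollider a b c) : P.IsNonCollider a b c := by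
  refine ⟨hu.1, hu.2.1, hu.2.2.1, ?_⟩
  have dir_of : ∀ {d}, P.Adj b d → P.mark d b = EdgeMark.tail → P.Dir b d := by
    intro d hd hm
    refine (hP.dir_iff hd).2 fun N hN => (hK.isMAG hN).dir_of_mark_tail (((hP _ _).1 N hN).1 hd) ?_
    exact ((hP d b).2 hd.symm).1.1 hm N hN
  cases hab : P.mark a b with
  | tail => exact .inl (dir_of hu.1.symm hab)
  | arrow =>
    exact .inr (.inl ((hP.dir_iff hu.2.1).2 fun N hN =>
      (h N hN).dir_of_arrow (((hP a b).2 hu.1).2.1 hab N hN)))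
  | circle =>
    cases hcb : P.mark c b with
    | tail => exact .inr (.inl (dir_of hu.2.1 hcb))
    | arrow =>
      exact .inl ((hP.dir_iff hu.1.symm).2 fun N hN =>
        (h N hN).symm.dir_of_arrow (((hP c b).2 hu.2.1.symm).2.1 hcb N hN))
    | circle => exact .inr (.inr ⟨rfl, rfl, hu.2.2.2⟩)

theorem IsRMEC.hasDefiniteOrder (hK : IsRMEC r M₀ K) (hP : P.IsPAG K) : P.HasDefiniteOrder := by
  intro n a b c h
  obtain ⟨N, hN⟩ := hK.nonempty
  have hNo := hP.hasOrderLE hN n a b c h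
  have hall := fun N' hN' => (hK.hasOrderLE hP hN (N' := N') hN' hNo).2
  obtain ⟨hab, hbc, hac⟩ := h.adj
  rcases (hK.isMAG hN).hasDefiniteOrder _ _ _ _ hNo with hc | hc
  · exact .inl (hP.isCollider_of_forall hab hbc hac fun N' hN' => (hall N' hN').1.1 hc)
  · right
    have hnc : ∀ N' ∈ K, N'.IsNonCollider a b c := fun N' hN' => (hall N' hN').2.1 hc
    -- Agreement of the members is already secured, so the induction only unfolds the order down to
    -- an unshielded triple or a discriminating path.
    clear hNo hall
    induction n with
    | zero => exact hK.isNonCollider_of_isUnshielded hP h hnc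
    | succ n ih =>
      rcases h with h | ⟨p, x, hp, -⟩
      · exact ih h
      · exact ⟨hab, hbc, hac, .inr (.inl ((hP.dir_iff hbc).2 fun N' hN' =>
          (hK.isMAG hN').dir_of_isDiscriminating (hP.isDiscriminating hN' hp) (hnc N' hN')))⟩

theorem IsRMEC.isNonCollider (hK : IsRMEC r M₀ K) (hP : P.IsPAG K) {N : MarkedGraph V}
    (hN : N ∈ K) {a b c : V} (h : P.IsNonCollider a b c) : N.IsNonCollider a b c := by
  obtain ⟨hab, hbc, hac, h⟩ := h
  have hab' := ((hP a b).1 N hN).1 hab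
  have hbc' := ((hP b c).1 N hN).1 hbc
  rcases h with h | h | ⟨h1, -, h3⟩
  · exact ⟨hab', hbc', hac, .inl (hP.dir hN h)⟩
  · exact ⟨hab', hbc', hac, .inr (.inl (hP.dir hN h))⟩
  -- An unshielded collider of one member is shared by all, so the PAG would show an arrowhead
  -- instead of the circle.
  · refine ((hK.isMAG hN).isCollider_or_isNonCollider hab' hbc' hac).resolve_left fun hc => ?_
    have hu : N.HasOrderLE 0 a b c := (hP.isUnshielded_iff hN).1 ⟨hab, hbc, hac, h3⟩
    have := (hP.isCollider_of_forall hab hbc hac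
      fun N' hN' => (hK.hasOrderLE hP hN hN' hu).2.1.1 hc).2.2.2.1
    rw [h1] at this
    cases this

/-- The separators in a MAG of the class are separators in the PAG. -/
theorem IsRMEC.isSeparator (hK : IsRMEC r M₀ K) (hP : P.IsPAG K) {N : MarkedGraph V}
    (hN : N ∈ K) {x y : V} {Z : Finset V} (hZ : N.IsSeparator x y Z) : P.IsSeparator x y Z := by
  refine ⟨hZ.1, hZ.2.1, ?_⟩
  rintro x' hx y' hy ⟨p, hp, hpZ⟩
  refine hZ.2.2 x' hx y' hy ⟨p, ⟨hp.1.imp fun a b => ((hP a b).1 N hN).1, hp.2⟩, ?_⟩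
  intro a b c habc
  rcases hpZ a b c habc with ⟨h, z, hz, hbz⟩ | ⟨h, hb⟩
  · exact .inl ⟨hP.isCollider hN h, z, hz, hP.anc hN hbz⟩
  · exact .inr ⟨hK.isNonCollider hP hN h, hb⟩

/-- A discriminating path of one member need not be displayed in the PAG a priori, so this direction
goes through the transfer with the PAG as second graph. -/
theorem IsRMEC.hasOrderLE_pag (hK : IsRMEC r M₀ K) (hP : P.IsPAG K) {N : MarkedGraph V}
    (hN : N ∈ K) {n : ℕ} {a b c : V} (h : N.HasOrderLE n a b c) : P.HasOrderLE n a b c := by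
  refine (ShareSeparators.hasOrderLE (H := P) ⟨fun a b => ((hP a b).1 N hN).symm, ?_⟩
    (hK.isMAG hN).hasDefiniteOrder (hK.hasDefiniteOrder hP) n a b c h).1
  intro x y hxy hadj
  obtain ⟨Z, -, hZ⟩ := hK.exists_separator hP hxy fun h' => hadj (((hP x y).1 N hN).1 h')
  exact ⟨Z, hZ N hN, hK.isSeparator hP hN (hZ N hN)⟩

theorem IsRMEC.tripleWithOrder_iff (hK : IsRMEC r M₀ K) (hP : P.IsPAG K) {a b c : V} :
    TripleWithOrder K a b c ↔ ∃ n, P.HasOrderLE n a b c := by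
  constructor
  · rintro ⟨N, hN, n, h⟩
    exact ⟨n, hK.hasOrderLE_pag hP hN h⟩
  · rintro ⟨n, h⟩
    obtain ⟨N, hN⟩ := hK.nonempty
    exact ⟨N, hN, n, hP.hasOrderLE hN n a b c h⟩

/-! ### Minimal separators -/

theorem IsSeparator.exists_minSep {x y : V} {Z : Finset V} (hZ : G.IsSeparator x y Z) :
    ∃ Z' ∈ G.MinSep x y, Z'.card ≤ Z.card := by
  induction Z using Finset.strongInduction with
  | H Z ih =>
    by_cases h : ∀ Z', Z' ⊂ Z → ¬ G.IsSeparator x y Z'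
    · exact ⟨Z, ⟨hZ, h⟩, le_rfl⟩
    · push Not at h
      obtain ⟨Z', hlt, hZ'⟩ := h
      obtain ⟨Z'', h1, h2⟩ := ih Z' hlt hZ'
      exact ⟨Z'', h1, h2.trans (Finset.card_le_card hlt.subset)⟩

theorem IsRMEC.exists_minSep (hK : IsRMEC r M₀ K) (hP : P.IsPAG K) {x y : V} (hxy : x ≠ y)
    (h : ¬ P.Adj x y) : ∃ Z ∈ P.MinSep x y, Z.card ≤ r := by
  obtain ⟨N, hN⟩ := hK.nonempty
  obtain ⟨Z, hZr, hZ⟩ := hK.exists_separator hP hxy h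
  obtain ⟨Z', h1, h2⟩ := (hK.isSeparator hP hN (hZ N hN)).exists_minSep
  exact ⟨Z', h1, h2.trans hZr⟩

theorem HasOrderLE.exists_corresponds {n : ℕ} {a b c : V} (h : G.HasOrderLE n a b c) :
    ∃ x y, G.Corresponds a b c x y := by
  induction n with
  | zero => exact ⟨a, c, h.2.2.1, h.2.2.2, .inl ⟨rfl, rfl, h⟩⟩
  | succ n ih =>
    rcases h with h | ⟨p, x, hp, -⟩
    · exact ih h
    · exact ⟨x, c, hp.ne, hp.2.2.2.1, .inr (.inl ⟨rfl, p, hp⟩)⟩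

theorem Corresponds.status {a b c x y : V} {Z : Finset V} (h : G.Corresponds a b c x y)
    (hZ : G.IsSeparator x y Z) :
    (G.IsCollider a b c → b ∉ Z) ∧ (G.IsNonCollider a b c → b ∈ Z) := by
  rcases h.2.2 with ⟨rfl, rfl, hu⟩ | ⟨rfl, p, hp⟩ | ⟨rfl, p, hp⟩
  · exact hu.last_triple hZ
  · exact hp.last_triple hZ
  · exact hp.last_triple hZ.symm

/-- Two `r`-PAGs with the same minimal separators of size at most `r` share separators. -/
theorem IsRMEC.shareSeparators_of_minSep {P' M₀' : MarkedGraph V} {K' : Set (MarkedGraph V)}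
    (hK : IsRMEC r M₀ K) (hP : P.IsPAG K) (hK' : IsRMEC r M₀' K') (hP' : P'.IsPAG K')
    (h : ∀ (x y : V) (Z : Finset V), Z.card ≤ r → (Z ∈ P.MinSep x y ↔ Z ∈ P'.MinSep x y)) :
    P.ShareSeparators P' where
  adj a b := by
    constructor
    · intro hab
      by_contra hab'
      -- Adjacent vertices have no separator, so the small minimal separators also determine the
      -- skeleton.
      obtain ⟨Z, hZ, hr⟩ := hK'.exists_minSep hP' hab.ne hab'
      exact ((h a b Z hr).2 hZ).1.not_adj hab
    · intro hab
      by_contra hab'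
      obtain ⟨Z, hZ, hr⟩ := hK.exists_minSep hP hab.ne hab'
      exact ((h a b Z hr).1 hZ).1.not_adj hab
  sep x y hxy hadj := by
    obtain ⟨Z, hZ, hr⟩ := hK.exists_minSep hP hxy hadj
    exact ⟨Z, hZ.1, ((h x y Z hr).1 hZ).1⟩

theorem IsRMEC.tripleWithOrder_of_minSep {P' M₀' : MarkedGraph V} {K' : Set (MarkedGraph V)}
    (hK : IsRMEC r M₀ K) (hP : P.IsPAG K) (hK' : IsRMEC r M₀' K') (hP' : P'.IsPAG K')
    (h : ∀ (x y : V) (Z : Finset V), Z.card ≤ r → (Z ∈ P.MinSep x y ↔ Z ∈ P'.MinSep x y))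
    {a b c : V} (ho : TripleWithOrder K a b c) :
    TripleWithOrder K' a b c ∧ P.SameStatus P' a b c := by
  obtain ⟨n, hn⟩ := (hK.tripleWithOrder_iff hP).1 ho
  have := (hK.shareSeparators_of_minSep hP hK' hP' h).hasOrderLE (hK.hasDefiniteOrder hP)
    (hK'.hasDefiniteOrder hP') n a b c hn
  exact ⟨(hK'.tripleWithOrder_iff hP').2 ⟨n, this.1⟩, this.2⟩

end PAG

end MarkedGraph

theorem proposition2 {V : Type*} [Finite V] (r : ℕ)
    (M₀ : MarkedGraph V) (hM₀ : M₀.IsMAG)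
    (K : Set (MarkedGraph V)) (hK : MarkedGraph.IsRMEC r M₀ K)
    (P : MarkedGraph V) (hP : P.IsPAG K) :
    -- the relation between a triple with order and the minimal separators of its pairs
    (∀ A B C : V, TripleWithOrder K A B C →
      (∃ X Y : V, P.Corresponds A B C X Y) ∧
      ∀ X Y : V, P.Corresponds A B C X Y →
        (∃ Z ∈ P.MinSep X Y, Z.card ≤ r) ∧
        ∀ Z ∈ P.MinSep X Y,
          (P.IsNonCollider A B C ↔ B ∈ Z) ∧ (P.IsCollider A B C ↔ B ∉ Z)) ∧
    -- the minimal separators determine all triples with order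
    (∀ (M₀' : MarkedGraph V) (K' : Set (MarkedGraph V)) (P' : MarkedGraph V),
      M₀'.IsMAG → MarkedGraph.IsRMEC r M₀' K' → P'.IsPAG K' →
      (∀ (X Y : V) (Z : Finset V), Z.card ≤ r → (Z ∈ P.MinSep X Y ↔ Z ∈ P'.MinSep X Y)) →
      ∀ A B C : V,
        ((TripleWithOrder K A B C ∧ P.IsNonCollider A B C) ↔
          (TripleWithOrder K' A B C ∧ P'.IsNonCollider A B C)) ∧
        ((TripleWithOrder K A B C ∧ P.IsCollider A B C) ↔
          (TripleWithOrder K' A B C ∧ P'.IsCollider A B C))) := by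
  refine ⟨fun A B C hT => ?_, ?_⟩
  · obtain ⟨n, hn⟩ := (hK.tripleWithOrder_iff hP).1 hT
    refine ⟨hn.exists_corresponds, fun X Y hXY => ⟨hK.exists_minSep hP hXY.1 hXY.2.1, ?_⟩⟩
    intro Z hZ
    have h1 := hXY.status hZ.1
    have h2 := hK.hasDefiniteOrder hP n A B C hn
    -- Definite status upgrades the two implications of `h1` to equivalences.
    tauto
  · intro M₀' K' P' _ hK' hP' h A B C
    have h1 := hK.tripleWithOrder_of_minSep hP hK' hP' h (a := A) (b := B) (c := C)
    have h2 := hK'.tripleWithOrder_of_minSep hP' hK hP (fun x y Z hr => (h x y Z hr).symm)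
      (a := A) (b := B) (c := C)
    constructor
    · exact ⟨fun h => ⟨(h1 h.1).1, (h1 h.1).2.2.1 h.2⟩, fun h => ⟨(h2 h.1).1, (h2 h.1).2.2.1 h.2⟩⟩
    · exact ⟨fun h => ⟨(h1 h.1).1, (h1 h.1).2.1.1 h.2⟩, fun h => ⟨(h2 h.1).1, (h2 h.1).2.1.1 h.2⟩⟩
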